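/- For each $k\in\mathbb N$ let $n=n_k$ and $m=m_k\ge 1$ be integers, $\boldsymbol\mu\in\mathbb R^n\setminus\{0\}$, and let $\boldsymbol\Sigma_{-1},\boldsymbol\Sigma_1$ be positive definite symmetric $n\times n$ matrices (all depending on $k$, without further restriction). Let $(\theta_i,\boldsymbol X_i)$, $i=1,\dots,m$, be independent copies of $(\theta,\boldsymbol X)$ with $\boldsymbol X=\theta\boldsymbol\mu+\boldsymbol g^{(\theta)}$, where $P(\theta=1)=P(\theta=-1)=1/2$ and, for $j=\pm1$, $\boldsymbol g^{(j)}\sim\mathcal N_n(\boldsymbol 0,\boldsymbol\Sigma_j)$ is independent of $\theta$. Let $\hat{\boldsymbol\gamma}$ be a (measurable) unit eigenvector of $\boldsymbol S_m=\frac1m\sum_{i=1}^m\boldsymbol X_i\boldsymbol X_i^\top$ for its largest eigenvalue, let $\lambda_1(\cdot)$ denote the largest eigenvalue, and put $$\eta=\frac{\|\boldsymbol\mu\|_2^2}{\max_{j=\pm1}\lambda_1(\boldsymbol\Sigma_j)} .$$ Observation $i$ is assigned to the class given by the sign of $\langle\hat{\boldsymbol\gamma},\boldsymbol X_i\rangle$.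 Suppose that, as $k\to\infty$, $n\to\infty$, $\frac{\log m}{n}\to0$ and $$\frac1\eta\max\Big\{\frac n{\sqrt m},\,n^{1/3},\,\log m\Big\}\to0 .$$ (i) Whatever the choice of the sign of $\hat{\boldsymbol\gamma}$, all observations are correctly clustered up to exchanging the names of the two clusters with probability tending to one: $$P\big(\exists s\in\{-1,1\}\ \forall i\le m:\ s\,\theta_i\langle\hat{\boldsymbol\gamma},\boldsymbol X_i\rangle>0\big)\to1 .$$ (ii) If the sign of $\hat{\boldsymbol\gamma}$ is fixed so that $\langle\hat{\boldsymbol\gamma},\boldsymbol\mu\rangle\ge0$ almost surely, then all observations are correctly labelled with probability tending to one, $$P\big(\forall i\le m:\ \theta_i\langle\hat{\boldsymbol\gamma},\boldsymbol X_i\rangle>0\big)\to1 ,$$ and the misclassification probability decays exponentially: for every $\varepsilon\in(0,1)$, for all sufficiently large $k$ and all $i\le m$, $$P\big(\theta_i\langle\hat{\boldsymbol\gamma},\boldsymbol X_i\rangle<0\big)\le \exp\!\big(-(1-\varepsilon)\,\eta/2\big)+10\,e^{-n}.$$ -/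

import Mathlib

open MeasureTheory ProbabilityTheory Filter Topology

noncomputable section

/-- The largest eigenvalue `λ₁(A)` of a real symmetric matrix. -/
def largestEigenvalue {n : ℕ} (A : Matrix (Fin n) (Fin n) ℝ) : ℝ :=
  sSup (spectrum ℝ A)

/-- `v` is a unit eigenvector of `A` for its largest eigenvalue. -/
structure IsLeadingEigenvector {n : ℕ} (A : Matrix (Fin n) (Fin n) ℝ)
    (v : EuclideanSpace ℝ (Fin n)) : Prop where
  norm_eq_one : ‖v‖ = 1
  eigen : A.toEuclideanLin v = largestEigenvalue A • v

/-- The sample matrix `S_m = (1/m) ∑ i, x_i x_iᵀ`. -/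
def secondMomentMatrix {n m : ℕ} (x : Fin m → EuclideanSpace ℝ (Fin n)) :
    Matrix (Fin n) (Fin n) ℝ :=
  (m : ℝ)⁻¹ • ∑ i, Matrix.vecMulVec (x i).ofLp (x i).ofLp

/-- A label in `ℤˣ = {-1, 1}` as a real number. -/
def labelReal (t : ℤˣ) : ℝ := ((t : ℤ) : ℝ)

/-- The mixture vector `X = θ μ + g^(θ)`. -/
def mixtureVector {n : ℕ} {Ω : Type*} (μ : EuclideanSpace ℝ (Fin n)) (θ : Ω → ℤˣ)
    (g : ℤˣ → Ω → EuclideanSpace ℝ (Fin n)) (ω : Ω) : EuclideanSpace ℝ (Fin n) :=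
  labelReal (θ ω) • μ + g (θ ω) ω

/-- `m` independent observations, with their labels, of the two-component Gaussian mixture
`X = θ μ + g^(θ)`: the label `θ` is Rademacher, and `g^(j) ∼ N(0, Σ_j)` is independent of `θ` for
`j = -1, 1`. No joint law of `g^(-1)` and `g^(1)` is prescribed, as only `g^(θ)` is used. -/
structure IsGaussianMixtureSample {n m : ℕ} {Ω : Type*} [MeasurableSpace Ω] (P : Measure Ω)
    (μ : EuclideanSpace ℝ (Fin n)) (S : ℤˣ → Matrix (Fin n) (Fin n) ℝ)
    (θ : Fin m → Ω → ℤˣ) (g : Fin m → ℤˣ → Ω → EuclideanSpace ℝ (Fin n)) : Prop where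
  measurable_label : ∀ i, Measurable (θ i)
  label_law : ∀ i j, P.real {ω | θ i ω = j} = 1 / 2
  noise_law : ∀ i j, HasLaw (g i j) (multivariateGaussian 0 (S j)) P
  indep_label_noise : ∀ i j, IndepFun (θ i) (g i j) P
  indep_obs : iIndepFun (fun i ω => (θ i ω, mixtureVector μ (θ i) (g i) ω)) P

/-- The signal-to-noise ratio `η = ‖μ‖² / max_j λ₁(Σ_j)`. -/
def signalToNoise {n : ℕ} (μ : EuclideanSpace ℝ (Fin n)) (S : ℤˣ → Matrix (Fin n) (Fin n) ℝ) : ℝ :=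
  ‖μ‖ ^ 2 / max (largestEigenvalue (S (-1))) (largestEigenvalue (S 1))

end

/-! Multiplying each observation by its label turns it into `μ + z i`, where the signed noises `z i`
are independent and subgaussian with variance proxy τ, the larger of the two `λ₁(Σ_j)`. The sample
matrix does not see the labels, so it may be studied through `μ + z i`.

Write M = ‖μ‖, so that η = M²/τ, and let w be the component of the eigenvector orthogonal to `μ`.
Pairing the eigenvalue equation with w removes the signal, and the eigenvalue is at least M²/2.
Hence ‖w‖ is at most of order √(τn/m)/M + (τ/M²)(1 + n/m)
(`IsLeadingEigenvector.norm_orthogonal_le`), once the mean and the directional second moments of the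
noise are controlled. That control comes from exponential moments and a volume comparison in place
of a net (`mul_measure_exists_le_of_midpointConvex`).

Observation i is then classified correctly unless ⟨μ, z i⟩ is close to -M² or below it, an event of
probability about exp(-η/2), or ‖z i‖ exceeds its order √(τn)
(`mul_inner_pos_of_norm_orthogonal_le`). Cauchy-Schwarz for ⟨w, z i⟩ suffices, although w depends on
z i: ‖w‖√(τn) is small against M exactly when n/√m and n^(1/3) are small against η. The conditions
on log m pay for the union over observations. -/

open scoped ENNReal in
theorem lintegral_finset_prod_comp_of_iIndepFun {Ω E ι : Type*} [MeasurableSpace Ω]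
    [MeasurableSpace E] {P : Measure Ω} (s : Finset ι) {Z : ι → Ω → E} (hZ : iIndepFun Z P)
    (hm : ∀ i, AEMeasurable (Z i) P) {f : E → ℝ≥0∞} (hf : Measurable f) :
    ∫⁻ ω, ∏ i ∈ s, f (Z i ω) ∂P = ∏ i ∈ s, ∫⁻ ω, f (Z i ω) ∂P := by
  have h := lintegral_prod_eq_prod_lintegral_of_indepFun s (fun i => f ∘ (hm i).mk (Z i))
    ((hZ.congr fun i => (hm i).ae_eq_mk).comp (fun _ => f) fun _ => hf)
    (fun i => hf.comp (hm i).measurable_mk)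
  have h1 : ∀ i, ∫⁻ ω, (f ∘ (hm i).mk (Z i)) ω ∂P = ∫⁻ ω, f (Z i ω) ∂P := fun i =>
    lintegral_congr_ae ((hm i).ae_eq_mk.symm.fun_comp f)
  simp_rw [h1] at h
  rw [← h]
  refine lintegral_congr_ae ?_
  have : ∀ᵐ ω ∂P, ∀ i ∈ s, Z i ω = (hm i).mk (Z i) ω :=
    (Finset.eventually_all s).2 fun i _ => (hm i).ae_eq_mk
  filter_upwards [this] with ω hω
  exact Finset.prod_congr rfl fun i hi => congrArg f (hω i hi)

/-! ### Rayleigh quotients and Gaussian marginals -/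

theorem inner_toEuclideanLin_le_largestEigenvalue {n : ℕ} {A : Matrix (Fin n) (Fin n) ℝ}
    (hA : A.IsHermitian) (x : EuclideanSpace ℝ (Fin n)) :
    inner ℝ x (A.toEuclideanLin x) ≤ largestEigenvalue A * ‖x‖ ^ 2 := by
  have hev : ∀ i, hA.eigenvalues i ≤ largestEigenvalue A := fun i =>
    le_csSup A.finite_real_spectrum.bddAbove
      (by rw [hA.spectrum_real_eq_range_eigenvalues]; exact ⟨i, rfl⟩)
  have hsymm := Matrix.isSymmetric_toEuclideanLin_iff.2 hA
  have hb : ∀ i, A.toEuclideanLin (hA.eigenvectorBasis i)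
      = hA.eigenvalues i • hA.eigenvectorBasis i := by
    intro i
    have := hA.mulVec_eigenvectorBasis i
    apply (WithLp.ofLp_injective 2)
    simpa [Matrix.toEuclideanLin] using this
  rw [← hA.eigenvectorBasis.sum_inner_mul_inner, ← real_inner_self_eq_norm_sq,
    ← hA.eigenvectorBasis.sum_inner_mul_inner, Finset.mul_sum]
  refine Finset.sum_le_sum fun i _ => ?_
  rw [← hsymm, hb, real_inner_smul_left, real_inner_comm x]
  nlinarith [hev i, mul_self_nonneg (inner ℝ x (hA.eigenvectorBasis i))]

theorem largestEigenvalue_pos {n : ℕ} {A : Matrix (Fin n) (Fin n) ℝ} (hA : A.PosDef)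
    {x : EuclideanSpace ℝ (Fin n)} (hx : x ≠ 0) : 0 < largestEigenvalue A := by
  have h1 := inner_toEuclideanLin_le_largestEigenvalue hA.1 x
  have h2 : 0 < inner ℝ x (A.toEuclideanLin x) := by
    have := hA.dotProduct_mulVec_pos (x := x.ofLp) (by simpa using hx)
    simpa [Matrix.toEuclideanLin, EuclideanSpace.inner_eq_star_dotProduct, dotProduct_comm]
      using this
  have h3 : 0 < ‖x‖ ^ 2 := by positivity
  by_contra h
  nlinarith

theorem hasLaw_inner_multivariateGaussian {n : ℕ} {S : Matrix (Fin n) (Fin n) ℝ}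
    (hS : S.PosSemidef) (x : EuclideanSpace ℝ (Fin n)) :
    (multivariateGaussian 0 S).map (fun y => inner ℝ x y)
      = gaussianReal 0 (inner ℝ x (S.toEuclideanLin x)).toNNReal := by
  have h := IsGaussian.map_eq_gaussianReal (μ := multivariateGaussian 0 S) (innerSL ℝ x)
  have h1 : (multivariateGaussian 0 S)[innerSL ℝ x] = 0 := by
    rw [ContinuousLinearMap.integral_comp_id_comm IsGaussian.integrable_id]
    simp
  have h2 : Var[innerSL ℝ x; multivariateGaussian 0 S] = inner ℝ x (S.toEuclideanLin x) := by
    have := covarianceBilin_multivariateGaussian (μ := 0) hS x x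
    rw [covarianceBilin_apply_eq_cov IsGaussian.memLp_two_id, covariance_self (by fun_prop)] at this
    simp only [EuclideanSpace.inner_eq_star_dotProduct, Matrix.toEuclideanLin]
    rw [dotProduct_comm]
    exact this
  rw [h1, h2] at h
  exact h

open scoped NNReal in
theorem lintegral_exp_gaussianReal (v : ℝ≥0) :
    ∫⁻ t, ENNReal.ofReal (Real.exp t) ∂(gaussianReal 0 v)
      = ENNReal.ofReal (Real.exp (v / 2)) := by
  rw [← ofReal_integral_eq_lintegral_ofReal]
  · have := congrFun (mgf_fun_id_gaussianReal (μ := 0) (v := v)) 1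
    simpa [mgf] using congrArg ENNReal.ofReal this
  · simpa using integrable_exp_mul_gaussianReal (μ := 0) (v := v) 1
  · exact ae_of_all _ fun t => (Real.exp_pos t).le

-- The integral is (1 - 2cv)^(-1/2), at most √2 when 4cv ≤ 1; the cruder 2 is enough.
open scoped NNReal in
theorem lintegral_exp_sq_gaussianReal (v : ℝ≥0) {c : ℝ} (hc : 4 * c * v ≤ 1) :
    ∫⁻ t, ENNReal.ofReal (Real.exp (c * t ^ 2)) ∂(gaussianReal 0 v) ≤ 2 := by
  rcases eq_or_ne v 0 with rfl | hv
  · simp [gaussianReal_zero_var]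
  have hv' : (0 : ℝ) < v := by positivity
  rw [gaussianReal_of_var_ne_zero _ hv, lintegral_withDensity_eq_lintegral_mul _
    (measurable_gaussianPDF 0 v) (by fun_prop)]
  set b : ℝ := 1 / (2 * v) - c with hb
  have hb4 : 1 / (4 * v) ≤ b := by
    have : c ≤ 1 / (4 * v) := by rw [le_div_iff₀ (by positivity)]; linarith
    have h2 : 1 / (2 * (v : ℝ)) = 1 / (4 * v) + 1 / (4 * v) := by field_simp; norm_num
    linarith
  have hb0 : 0 < b := lt_of_lt_of_le (by positivity) hb4
  have heq : ∀ t, (gaussianPDF 0 v * fun t => ENNReal.ofReal (Real.exp (c * t ^ 2))) t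
      = ENNReal.ofReal ((√(2 * Real.pi * v))⁻¹ * Real.exp (-b * t ^ 2)) := by
    intro t
    rw [Pi.mul_apply, gaussianPDF, gaussianPDFReal, ← ENNReal.ofReal_mul (by positivity), mul_assoc,
      ← Real.exp_add]
    congr 3
    rw [hb]; field_simp; ring
  simp_rw [heq]
  rw [← ofReal_integral_eq_lintegral_ofReal ((integrable_exp_neg_mul_sq hb0).const_mul _)
    (ae_of_all _ fun t => by positivity), integral_const_mul, integral_gaussian]
  rw [show (2 : ENNReal) = ENNReal.ofReal 2 by simp]
  apply ENNReal.ofReal_le_ofReal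
  rw [inv_mul_le_iff₀ (by positivity)]
  rw [show √(2 * Real.pi * v) * 2 = √(2 * Real.pi * v * 2 ^ 2) by
    rw [Real.sqrt_mul (by positivity) (2 ^ 2), Real.sqrt_sq (by norm_num)]]
  apply Real.sqrt_le_sqrt
  rw [div_le_iff₀ hb0]
  rw [div_le_iff₀ (by positivity)] at hb4
  have := Real.pi_pos
  nlinarith [mul_le_mul_of_nonneg_left hb4 this.le]

/-! ### The signed noise and its exponential moments -/

/-- The largest of the two noise variances. -/
noncomputable def noiseLevel {n : ℕ} (S : ℤˣ → Matrix (Fin n) (Fin n) ℝ) : ℝ :=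
  max (largestEigenvalue (S (-1))) (largestEigenvalue (S 1))

theorem inner_toEuclideanLin_le_noiseLevel {n : ℕ} {S : ℤˣ → Matrix (Fin n) (Fin n) ℝ}
    (hS : ∀ j, (S j).PosDef) (j : ℤˣ) (x : EuclideanSpace ℝ (Fin n)) :
    inner ℝ x ((S j).toEuclideanLin x) ≤ noiseLevel S * ‖x‖ ^ 2 := by
  refine (inner_toEuclideanLin_le_largestEigenvalue (hS j).1 x).trans ?_
  refine mul_le_mul_of_nonneg_right ?_ (by positivity)
  rcases Int.units_eq_one_or j with rfl | rfl
  · exact le_max_right _ _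
  · exact le_max_left _ _

theorem measurable_labelReal : Measurable labelReal :=
  (measurable_from_top (f := fun z : ℤ => (z : ℝ))).comp (comap_measurable _)

theorem labelReal_injective : Function.Injective labelReal :=
  Int.cast_injective.comp Units.val_injective

@[simp] theorem labelReal_mul_self (t : ℤˣ) : labelReal t * labelReal t = 1 := by
  rcases Int.units_eq_one_or t with rfl | rfl <;> simp [labelReal]

theorem labelReal_mul (s t : ℤˣ) : labelReal (s * t) = labelReal s * labelReal t := by
  simp [labelReal]

/-- The noise of an observation after multiplication by its label. -/
noncomputable def signedNoise {n m : ℕ} {Ω : Type*} (θ : Fin m → Ω → ℤˣ)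
    (g : Fin m → ℤˣ → Ω → EuclideanSpace ℝ (Fin n)) (i : Fin m) (ω : Ω) :
    EuclideanSpace ℝ (Fin n) :=
  labelReal (θ i ω) • g i (θ i ω) ω

theorem mixtureVector_eq {n m : ℕ} {Ω : Type*} (μ : EuclideanSpace ℝ (Fin n))
    (θ : Fin m → Ω → ℤˣ) (g : Fin m → ℤˣ → Ω → EuclideanSpace ℝ (Fin n)) (i : Fin m) (ω : Ω) :
    mixtureVector μ (θ i) (g i) ω = labelReal (θ i ω) • (μ + signedNoise θ g i ω) := by
  rw [mixtureVector, signedNoise, smul_add, smul_smul, labelReal_mul_self, one_smul]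

theorem signedNoise_eq_sum {n m : ℕ} {Ω : Type*} (θ : Fin m → Ω → ℤˣ)
    (g : Fin m → ℤˣ → Ω → EuclideanSpace ℝ (Fin n)) (i : Fin m) :
    signedNoise θ g i = fun ω => ∑ j : ℤˣ,
      ({ω | θ i ω = j}.indicator (fun ω => labelReal j • g i j ω) ω) := by
  ext1 ω
  rw [Finset.sum_eq_single (θ i ω)]
  · simp [signedNoise]
  · intro j _ hj
    simp [Ne.symm hj]
  · exact fun h => (h (Finset.mem_univ _)).elim

section Sample

variable {n m : ℕ} {Ω : Type*} [MeasurableSpace Ω] {P : Measure Ω}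
  {μ : EuclideanSpace ℝ (Fin n)} {S : ℤˣ → Matrix (Fin n) (Fin n) ℝ}
  {θ : Fin m → Ω → ℤˣ} {g : Fin m → ℤˣ → Ω → EuclideanSpace ℝ (Fin n)}

namespace IsGaussianMixtureSample

/-- The signed noise is `θ X - μ`, a function of the pair (label, observation), so independence of
these pairs is all that is needed. -/
theorem iIndepFun_signedNoise (h : IsGaussianMixtureSample P μ S θ g) :
    iIndepFun (signedNoise θ g) P := by
  have := h.indep_obs.comp (fun _ p => labelReal p.1 • p.2 - μ) fun _ =>
    ((measurable_labelReal.comp measurable_fst).smul measurable_snd).sub_const μ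
  convert this using 2 with i
  ext1 ω
  simp [mixtureVector_eq, smul_smul]

theorem measurableSet_label (h : IsGaussianMixtureSample P μ S θ g) (i : Fin m) (j : ℤˣ) :
    MeasurableSet {ω | θ i ω = j} := by
  have h1 := (measurable_labelReal.comp (h.measurable_label i))
    (measurableSet_singleton (labelReal j))
  convert h1 using 1
  ext ω
  exact labelReal_injective.eq_iff.symm

theorem aemeasurable_signedNoise (h : IsGaussianMixtureSample P μ S θ g) (i : Fin m) :
    AEMeasurable (signedNoise θ g i) P := by
  rw [signedNoise_eq_sum]
  refine Finset.aemeasurable_fun_sum _ fun j _ => ?_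
  exact ((h.noise_law i j).aemeasurable.const_smul (labelReal j)).indicator (h.measurableSet_label i j)

-- Splitting over the value j of the label leaves only `g^(j)`, which is independent of the label;
-- the two pieces have weight 1/2 each. The joint law of the two noises never enters.
open scoped ENNReal in
theorem lintegral_signedNoise_le [IsProbabilityMeasure P]
    (h : IsGaussianMixtureSample P μ S θ g) (i : Fin m)
    {f : EuclideanSpace ℝ (Fin n) → ℝ≥0∞} (hf : Measurable f) {K : ℝ≥0∞}
    (hK : ∀ j, ∫⁻ y, f (labelReal j • y) ∂(multivariateGaussian 0 (S j)) ≤ K) :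
    ∫⁻ ω, f (signedNoise θ g i ω) ∂P ≤ K := by
  have hj : ∀ j, ∫⁻ ω, {ω | θ i ω = j}.indicator 1 ω * f (labelReal j • g i j ω) ∂P
      ≤ ENNReal.ofReal (1 / 2) * K := by
    intro j
    have hmf : Measurable fun y : EuclideanSpace ℝ (Fin n) => f (labelReal j • y) :=
      hf.comp (measurable_id.const_smul (labelReal j))
    have hset : MeasurableSet ({j} : Set ℤˣ) := by
      convert measurable_labelReal (measurableSet_singleton (labelReal j)) using 1
      ext t
      exact labelReal_injective.eq_iff.symm
    have hind := (h.indep_label_noise i j).comp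
      (φ := fun t => ({j} : Set ℤˣ).indicator (1 : ℤˣ → ℝ≥0∞) t)
      (ψ := fun y => f (labelReal j • y)) (measurable_one.indicator hset) hmf
    have key := lintegral_mul_eq_lintegral_mul_lintegral_of_indepFun''
      (((measurable_one.indicator hset).comp (h.measurable_label i)).aemeasurable)
      (hmf.comp_aemeasurable (h.noise_law i j).aemeasurable) hind
    have e1 : ∀ ω, ((fun t => ({j} : Set ℤˣ).indicator (1 : ℤˣ → ℝ≥0∞) t) ∘ θ i) ω
        = {ω | θ i ω = j}.indicator 1 ω := fun ω => by
      simp [Set.indicator_apply]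
    have e2 : ∫⁻ ω, ((fun y => f (labelReal j • y)) ∘ g i j) ω ∂P
        = ∫⁻ y, f (labelReal j • y) ∂(multivariateGaussian 0 (S j)) := by
      rw [← (h.noise_law i j).map_eq, lintegral_map' hmf.aemeasurable (h.noise_law i j).aemeasurable]
      rfl
    have e3 : ∫⁻ ω, {ω | θ i ω = j}.indicator 1 ω ∂P = ENNReal.ofReal (1 / 2) := by
      rw [lintegral_indicator_one (h.measurableSet_label i j), ← h.label_law i j, ofReal_measureReal]
    rw [e2] at key
    simp_rw [e1] at key
    rw [e3] at key
    exact key.le.trans (mul_le_mul_right (hK j) _)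
  have hsplit : ∀ ω, f (signedNoise θ g i ω)
      = ∑ j : ℤˣ, {ω | θ i ω = j}.indicator 1 ω * f (labelReal j • g i j ω) := by
    intro ω
    rw [Finset.sum_eq_single (θ i ω)]
    · simp [signedNoise]
    · intro j _ hj
      simp [Ne.symm hj]
    · exact fun h => (h (Finset.mem_univ _)).elim
  simp_rw [hsplit]
  have hmeas : ∀ j, AEMeasurable
      (fun ω => {ω | θ i ω = j}.indicator 1 ω * f (labelReal j • g i j ω)) P := fun j =>
    AEMeasurable.mul (measurable_one.indicator (h.measurableSet_label i j)).aemeasurable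
      (hf.comp_aemeasurable ((h.noise_law i j).aemeasurable.const_smul (labelReal j)))
  rw [lintegral_finsetSum' _ fun j _ => hmeas j]
  refine (Finset.sum_le_sum fun j _ => hj j).trans ?_
  rw [Finset.sum_const, Finset.card_univ, Fintype.card_units_int, nsmul_eq_mul, ← mul_assoc]
  have : ((2 : ℕ) : ℝ≥0∞) * ENNReal.ofReal (1 / 2) = 1 := by
    rw [← ENNReal.ofReal_natCast, ← ENNReal.ofReal_mul (by positivity)]; simp
  rw [this, one_mul]

theorem lintegral_comp_inner_smul {f : ℝ → ENNReal} (hf : Measurable f)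
    {A : Matrix (Fin n) (Fin n) ℝ}
    (hA : A.PosSemidef) (x : EuclideanSpace ℝ (Fin n)) (j : ℤˣ) :
    ∫⁻ y, f (inner ℝ x (labelReal j • y)) ∂(multivariateGaussian 0 A)
      = ∫⁻ t, f t ∂(gaussianReal 0 (inner ℝ x (A.toEuclideanLin x)).toNNReal) := by
  have h1 : inner ℝ (labelReal j • x) (A.toEuclideanLin (labelReal j • x))
      = inner ℝ x (A.toEuclideanLin x) := by
    rw [map_smul, real_inner_smul_left, real_inner_smul_right, ← mul_assoc, labelReal_mul_self,
      one_mul]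
  rw [← h1, ← hasLaw_inner_multivariateGaussian hA, lintegral_map hf (by fun_prop)]
  simp_rw [real_inner_smul_left, real_inner_smul_right]

theorem lintegral_exp_inner_signedNoise_le [IsProbabilityMeasure P] (h : IsGaussianMixtureSample P μ S θ g)
    (hS : ∀ j, (S j).PosDef) (i : Fin m) (x : EuclideanSpace ℝ (Fin n)) :
    ∫⁻ ω, ENNReal.ofReal (Real.exp (inner ℝ x (signedNoise θ g i ω))) ∂P
      ≤ ENNReal.ofReal (Real.exp (noiseLevel S * ‖x‖ ^ 2 / 2)) := by
  refine h.lintegral_signedNoise_le i (f := fun y => ENNReal.ofReal (Real.exp (inner ℝ x y)))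
    (by fun_prop) fun j => ?_
  rw [lintegral_comp_inner_smul (f := fun t => ENNReal.ofReal (Real.exp t)) (by fun_prop)
    (hS j).posSemidef, lintegral_exp_gaussianReal]
  have h1 := inner_toEuclideanLin_le_noiseLevel hS j x
  have h2 : 0 ≤ inner ℝ x ((S j).toEuclideanLin x) := by
    simpa [Matrix.toEuclideanLin, EuclideanSpace.inner_eq_star_dotProduct, dotProduct_comm]
      using (hS j).posSemidef.dotProduct_mulVec_nonneg x.ofLp
  rw [Real.coe_toNNReal _ h2]
  gcongr

theorem lintegral_exp_sq_inner_signedNoise_le [IsProbabilityMeasure P] (h : IsGaussianMixtureSample P μ S θ g)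
    (hS : ∀ j, (S j).PosDef) (i : Fin m) (x : EuclideanSpace ℝ (Fin n)) {c : ℝ} (hc0 : 0 ≤ c)
    (hc : 4 * c * (noiseLevel S * ‖x‖ ^ 2) ≤ 1) :
    ∫⁻ ω, ENNReal.ofReal (Real.exp (c * inner ℝ x (signedNoise θ g i ω) ^ 2)) ∂P ≤ 2 := by
  refine h.lintegral_signedNoise_le i
    (f := fun y => ENNReal.ofReal (Real.exp (c * inner ℝ x y ^ 2))) (by fun_prop) fun j => ?_
  rw [lintegral_comp_inner_smul (f := fun t => ENNReal.ofReal (Real.exp (c * t ^ 2))) (by fun_prop)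
    (hS j).posSemidef]
  apply lintegral_exp_sq_gaussianReal
  have h1 := inner_toEuclideanLin_le_noiseLevel hS j x
  have h2 : 0 ≤ inner ℝ x ((S j).toEuclideanLin x) := by
    simpa [Matrix.toEuclideanLin, EuclideanSpace.inner_eq_star_dotProduct, dotProduct_comm]
      using (hS j).posSemidef.dotProduct_mulVec_nonneg x.ofLp
  rw [Real.coe_toNNReal _ h2]
  exact (mul_le_mul_of_nonneg_left h1 (by positivity)).trans hc

end IsGaussianMixtureSample

end Sample

/-! ### A maximal inequality over the unit ball -/

theorem two_mul_exp_le_of_two_mul_le_add {a b q : ℝ} (h : 2 * q ≤ a + b) :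
    2 * Real.exp q ≤ Real.exp a + Real.exp b := by
  have h1 : Real.exp q ≤ Real.exp (a / 2) * Real.exp (b / 2) := by
    rw [← Real.exp_add]; apply Real.exp_le_exp.2; linarith
  have ha : Real.exp a = Real.exp (a / 2) ^ 2 := by rw [← Real.exp_nat_mul]; congr 1; push_cast; ring
  have hb : Real.exp b = Real.exp (b / 2) ^ 2 := by rw [← Real.exp_nat_mul]; congr 1; push_cast; ring
  rw [ha, hb]
  nlinarith [sq_nonneg (Real.exp (a / 2) - Real.exp (b / 2))]

theorem two_mul_ofReal_exp_le {a b q : ℝ} (h : 2 * q ≤ a + b) :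
    2 * ENNReal.ofReal (Real.exp q) ≤ ENNReal.ofReal (Real.exp a) + ENNReal.ofReal (Real.exp b) := by
  rw [← ENNReal.ofReal_add (Real.exp_pos _).le (Real.exp_pos _).le,
    show (2 : ENNReal) = ENNReal.ofReal 2 by simp, ← ENNReal.ofReal_mul (by norm_num)]
  exact ENNReal.ofReal_le_ofReal (two_mul_exp_le_of_two_mul_le_add h)

open scoped ENNReal in
/-- A maximal inequality: a function that is midpoint convex is dominated on the unit ball by a
multiple of its average over the ball of radius two. -/
theorem mul_measure_exists_le_of_midpointConvex {n : ℕ} [NeZero n] {Ω Y : Type*}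
    [MeasurableSpace Ω] [MeasurableSpace Y] {P : Measure Ω} [SFinite P] {W : Ω → Y}
    (hW : AEMeasurable W P)
    {F : EuclideanSpace ℝ (Fin n) → Y → ℝ≥0∞} (hF : Measurable (Function.uncurry F))
    (hconv : ∀ y v u, 2 * F v y ≤ F (v + u) y + F (v - u) y) {K : ℝ≥0∞}
    (hK : ∀ x, ‖x‖ ≤ 2 → ∫⁻ ω, F x (W ω) ∂P ≤ K) (a : ℝ≥0∞) :
    a * P {ω | ∃ v, ‖v‖ ≤ 1 ∧ a ≤ F v (W ω)} ≤ 2 ^ n * K := by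
  set B1 : Set (EuclideanSpace ℝ (Fin n)) := Metric.closedBall 0 1 with hB1
  set B2 : Set (EuclideanSpace ℝ (Fin n)) := Metric.closedBall 0 2 with hB2
  have hB2m : MeasurableSet B2 := measurableSet_closedBall
  have hFs : ∀ y, Measurable fun x => F x y := fun y => hF.comp (measurable_id.prodMk measurable_const)
  have hpt : ∀ y v, ‖v‖ ≤ 1 → F v y * volume B1 ≤ ∫⁻ x in B2, F x y := by
    intro y v hv
    have hmG : Measurable (B2.indicator fun x => F x y) := (hFs y).indicator hB2m
    have h1 : ∫⁻ u, B2.indicator (fun x => F x y) (v + u) = ∫⁻ x in B2, F x y := by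
      rw [lintegral_add_left_eq_self (fun x => B2.indicator (fun x => F x y) x) v,
        lintegral_indicator hB2m]
    have h2 : ∫⁻ u, B2.indicator (fun x => F x y) (v - u) = ∫⁻ x in B2, F x y := by
      rw [lintegral_sub_left_eq_self (fun x => B2.indicator (fun x => F x y) x) v,
        lintegral_indicator hB2m]
    -- Midpoint convexity is integrated over u in the unit ball; v + u and v - u both stay in the
    -- ball of radius 2.
    have h3 : 2 * (F v y * volume B1) ≤ 2 * ∫⁻ x in B2, F x y := by
      calc 2 * (F v y * volume B1) = ∫⁻ u in B1, 2 * F v y := by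
            rw [setLIntegral_const, mul_assoc]
        _ ≤ ∫⁻ u in B1, (B2.indicator (fun x => F x y) (v + u)
              + B2.indicator (fun x => F x y) (v - u)) := by
            refine setLIntegral_mono' measurableSet_closedBall fun u hu => ?_
            have hu' : ‖u‖ ≤ 1 := by simpa [hB1] using hu
            have e1 : v + u ∈ B2 := by
              simpa [hB2] using (norm_add_le v u).trans (by linarith)
            have e2 : v - u ∈ B2 := by
              simpa [hB2] using (norm_sub_le v u).trans (by linarith)
            rw [Set.indicator_of_mem e1, Set.indicator_of_mem e2]
            exact hconv y v u
        _ ≤ ∫⁻ u, (B2.indicator (fun x => F x y) (v + u)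
              + B2.indicator (fun x => F x y) (v - u)) := setLIntegral_le_lintegral _ _
        _ = 2 * ∫⁻ x in B2, F x y := by
            rw [lintegral_add_left (by exact hmG.comp (measurable_const_add v)), h1, h2, two_mul]
    exact (ENNReal.mul_le_mul_iff_right (by simp) (by simp)).1 h3
  have hjoint : AEMeasurable (Function.uncurry fun ω x => F x (W ω))
      (P.prod (volume.restrict B2)) :=
    hF.comp_aemeasurable (measurable_snd.aemeasurable.prodMk hW.comp_fst)
  have hswap : ∫⁻ ω, (∫⁻ x in B2, F x (W ω)) ∂P ≤ volume B2 * K := by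
    rw [lintegral_lintegral_swap hjoint]
    calc ∫⁻ x in B2, ∫⁻ ω, F x (W ω) ∂P ≤ ∫⁻ x in B2, K :=
          setLIntegral_mono' hB2m fun x hx => hK x (by simpa [hB2] using hx)
      _ = volume B2 * K := by rw [setLIntegral_const, mul_comm]
  have hvol : volume B2 = 2 ^ n * volume B1 := by
    rw [hB2, hB1, Measure.addHaar_closedBall _ _ (by norm_num : (0 : ℝ) ≤ 2),
      Measure.addHaar_closedBall _ _ (by norm_num : (0 : ℝ) ≤ 1)]
    simp [ENNReal.ofReal_pow]
  have hv0 : volume B1 ≠ 0 := (Metric.measure_closedBall_pos _ _ one_pos).ne'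
  have hvt : volume B1 ≠ ∞ := measure_closedBall_lt_top.ne
  have hmarkov := mul_meas_ge_le_lintegral₀ (μ := P) (f := fun ω => ∫⁻ x in B2, F x (W ω))
    hjoint.lintegral_prod_right' (a * volume B1)
  -- The event with the uncountable quantifier need not be measurable; it is enclosed in a level set
  -- of the ball integral, to which Markov applies.
  have hsub : {ω | ∃ v, ‖v‖ ≤ 1 ∧ a ≤ F v (W ω)}
      ⊆ {ω | a * volume B1 ≤ ∫⁻ x in B2, F x (W ω)} := by
    rintro ω ⟨v, hv, hav⟩
    exact (mul_le_mul_left hav _).trans (hpt _ v hv)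
  have := ((mul_le_mul_right (measure_mono hsub) _).trans hmarkov).trans hswap
  rw [hvol] at this
  refine (ENNReal.mul_le_mul_iff_right hv0 hvt).1 ?_
  calc volume B1 * (a * P {ω | ∃ v, ‖v‖ ≤ 1 ∧ a ≤ F v (W ω)})
      = a * volume B1 * P {ω | ∃ v, ‖v‖ ≤ 1 ∧ a ≤ F v (W ω)} := by ring
    _ ≤ 2 ^ n * volume B1 * K := this
    _ = volume B1 * (2 ^ n * K) := by ring

theorem measureReal_le_of_ofReal_exp_mul_le {Ω : Type*} [MeasurableSpace Ω] {P : Measure Ω}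
    {s : Set Ω} {a b : ℝ}
    (h : ENNReal.ofReal (Real.exp a) * P s ≤ ENNReal.ofReal (Real.exp b)) :
    P.real s ≤ Real.exp (b - a) := by
  have h1 := ENNReal.toReal_mono ENNReal.ofReal_ne_top h
  rw [ENNReal.toReal_mul, ENNReal.toReal_ofReal (Real.exp_pos _).le,
    ENNReal.toReal_ofReal (Real.exp_pos _).le] at h1
  rw [Real.exp_sub, le_div_iff₀ (Real.exp_pos _), mul_comm]
  exact h1

theorem ennreal_two_pow_eq (n : ℕ) :
    (2 : ENNReal) ^ n = ENNReal.ofReal (Real.exp (n * Real.log 2)) := by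
  rw [Real.exp_nat_mul, Real.exp_log (by norm_num), ENNReal.ofReal_pow (by norm_num)]
  simp

/-- The norm is the supremum of linear forms over the unit ball, so the maximal inequality applies
to exp(c⟨x, W⟩). The rate 5/4 exceeds 1 so that a union over m observations still leaves exp(-n). -/
theorem measureReal_norm_ge_le_of_subgaussian {n : ℕ} [NeZero n] {Ω : Type*} [MeasurableSpace Ω]
    {P : Measure Ω} [SFinite P] {W : Ω → EuclideanSpace ℝ (Fin n)} (hW : AEMeasurable W P)
    {τ : ℝ} (hτ : 0 < τ)
    (h : ∀ x, ∫⁻ ω, ENNReal.ofReal (Real.exp (inner ℝ x (W ω))) ∂P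
      ≤ ENNReal.ofReal (Real.exp (τ * ‖x‖ ^ 2 / 2))) :
    P.real {ω | 4 * √(τ * n) ≤ ‖W ω‖} ≤ Real.exp (-(5 / 4 * n)) := by
  set t := 4 * √(τ * n) with ht
  have ht0 : 0 ≤ t := by positivity
  have ht2 : t ^ 2 = 16 * (τ * n) := by rw [ht, mul_pow, Real.sq_sqrt (by positivity)]; norm_num
  -- This c minimizes 2τc² - ct, with minimum -t²/(8τ) = -2n; the volume factor 2^n costs less than
  -- 3n/4.
  set c := t / (4 * τ) with hc
  have hc0 : 0 ≤ c := by positivity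
  have key := mul_measure_exists_le_of_midpointConvex (P := P) hW
    (F := fun x w => ENNReal.ofReal (Real.exp (c * inner ℝ x w)))
    (by unfold Function.uncurry; fun_prop)
    (fun y v u => two_mul_ofReal_exp_le (by rw [inner_add_left, inner_sub_left]; linarith))
    (K := ENNReal.ofReal (Real.exp (2 * τ * c ^ 2)))
    (fun x hx => by
      have h1 := h (c • x)
      simp_rw [real_inner_smul_left] at h1
      refine h1.trans (ENNReal.ofReal_le_ofReal (Real.exp_le_exp.2 ?_))
      rw [norm_smul, mul_pow, Real.norm_of_nonneg hc0]
      have : ‖x‖ ^ 2 ≤ 2 ^ 2 := by gcongr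
      have : τ * (c ^ 2 * ‖x‖ ^ 2) ≤ τ * (c ^ 2 * 2 ^ 2) := by gcongr
      linarith)
    (ENNReal.ofReal (Real.exp (c * t)))
  rw [ennreal_two_pow_eq, ← ENNReal.ofReal_mul (Real.exp_pos _).le, ← Real.exp_add] at key
  refine (measureReal_mono ?_ ?_).trans ((measureReal_le_of_ofReal_exp_mul_le key).trans ?_)
  · intro ω hω
    have hω : t ≤ ‖W ω‖ := hω
    refine ⟨‖W ω‖⁻¹ • W ω, ?_, ?_⟩
    · rw [norm_smul, norm_inv, norm_norm]
      exact inv_mul_le_one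
    · apply ENNReal.ofReal_le_ofReal
      apply Real.exp_le_exp.2
      apply mul_le_mul_of_nonneg_left _ hc0
      rw [real_inner_smul_left, real_inner_self_eq_norm_sq]
      rcases eq_or_ne ‖W ω‖ 0 with h0 | h0
      · rw [h0] at hω ⊢; simpa using hω
      · rw [pow_two, inv_mul_cancel_left₀ h0]; exact hω
  -- Monotonicity of real-valued measures needs a finite larger set, and `P` is only s-finite; the
  -- bound `key` supplies this.
  · intro htop
    rw [htop, ENNReal.mul_top (by simp [Real.exp_pos])] at key
    exact absurd key (by simp)
  · apply Real.exp_le_exp.2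
    have e1 : 2 * τ * c ^ 2 - c * t = -(2 * n) := by
      rw [hc, div_pow, ht2]
      rw [show t / (4 * τ) * t = t ^ 2 / (4 * τ) by ring, ht2]
      field_simp
      ring
    have := Real.log_two_lt_d9
    have hn : (0 : ℝ) ≤ n := by positivity
    nlinarith

/-! ### Deviation bounds for the noise -/

namespace IsGaussianMixtureSample

variable {n m : ℕ} [NeZero n] {Ω : Type*} [MeasurableSpace Ω] {P : Measure Ω}
  [IsProbabilityMeasure P]
  {μ : EuclideanSpace ℝ (Fin n)} {S : ℤˣ → Matrix (Fin n) (Fin n) ℝ}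
  {θ : Fin m → Ω → ℤˣ} {g : Fin m → ℤˣ → Ω → EuclideanSpace ℝ (Fin n)}

theorem measureReal_norm_signedNoise_ge_le (h : IsGaussianMixtureSample P μ S θ g)
    (hS : ∀ j, (S j).PosDef) (hτ : 0 < noiseLevel S) (i : Fin m) :
    P.real {ω | 4 * √(noiseLevel S * n) ≤ ‖signedNoise θ g i ω‖} ≤ Real.exp (-(5 / 4 * n)) :=
  measureReal_norm_ge_le_of_subgaussian (h.aemeasurable_signedNoise i) hτ
    (h.lintegral_exp_inner_signedNoise_le hS i)

theorem measureReal_norm_sum_signedNoise_ge_le (h : IsGaussianMixtureSample P μ S θ g)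
    (hS : ∀ j, (S j).PosDef) (hτ : 0 < noiseLevel S) (hm : 1 ≤ m) :
    P.real {ω | 4 * √(m * noiseLevel S * n) ≤ ‖∑ i, signedNoise θ g i ω‖}
      ≤ Real.exp (-(5 / 4 * n)) := by
  have hm' : (0 : ℝ) < m := by exact_mod_cast hm
  refine measureReal_norm_ge_le_of_subgaussian
    (Finset.aemeasurable_fun_sum _ fun i _ => h.aemeasurable_signedNoise i) (by positivity)
    fun x => ?_
  have hprod : ∀ ω, ENNReal.ofReal (Real.exp (inner ℝ x (∑ i, signedNoise θ g i ω)))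
      = ∏ i, ENNReal.ofReal (Real.exp (inner ℝ x (signedNoise θ g i ω))) := fun ω => by
    rw [inner_sum, Real.exp_sum, ENNReal.ofReal_prod_of_nonneg fun _ _ => (Real.exp_pos _).le]
  simp_rw [hprod]
  have hf : Measurable fun z : EuclideanSpace ℝ (Fin n) =>
    ENNReal.ofReal (Real.exp (inner ℝ x z)) := by fun_prop
  rw [lintegral_finset_prod_comp_of_iIndepFun _ h.iIndepFun_signedNoise h.aemeasurable_signedNoise hf]
  refine (Finset.prod_le_prod' fun i _ => h.lintegral_exp_inner_signedNoise_le hS i x).trans ?_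
  rw [Finset.prod_const, Finset.card_univ, Fintype.card_fin,
    ← ENNReal.ofReal_pow (Real.exp_pos _).le, ← Real.exp_nat_mul]
  exact ENNReal.ofReal_le_ofReal (Real.exp_le_exp.2 (by rw [mul_div_assoc', mul_assoc]))

theorem measureReal_exists_sum_sq_inner_ge_le (h : IsGaussianMixtureSample P μ S θ g)
    (hS : ∀ j, (S j).PosDef) (hτ : 0 < noiseLevel S) :
    P.real {ω | ∃ v : EuclideanSpace ℝ (Fin n), ‖v‖ ≤ 1 ∧
      16 * noiseLevel S * (2 * n + m) ≤ ∑ i, inner ℝ v (signedNoise θ g i ω) ^ 2}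
      ≤ Real.exp (-n) := by
  set τ := noiseLevel S
  -- The largest c for which 4cτ‖x‖² ≤ 1 on the whole ball of radius 2. Each observation then
  -- contributes a factor at most 2.
  set c : ℝ := 1 / (16 * τ) with hc
  have hc0 : 0 ≤ c := by positivity
  have key := mul_measure_exists_le_of_midpointConvex (P := P)
    (W := fun ω i => signedNoise θ g i ω)
    (aemeasurable_pi_lambda _ fun i => h.aemeasurable_signedNoise i)
    (F := fun x w => ENNReal.ofReal (Real.exp (c * ∑ i, inner ℝ x (w i) ^ 2)))
    (by unfold Function.uncurry; fun_prop)
    (fun y v u => two_mul_ofReal_exp_le (by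
      rw [← mul_add, ← Finset.sum_add_distrib, mul_left_comm, Finset.mul_sum]
      refine mul_le_mul_of_nonneg_left (Finset.sum_le_sum fun i _ => ?_) hc0
      rw [inner_add_left, inner_sub_left]
      nlinarith [sq_nonneg (inner ℝ u (y i))]))
    (K := 2 ^ m)
    (fun x hx => by
      have hprod : ∀ ω, ENNReal.ofReal (Real.exp (c * ∑ i, inner ℝ x (signedNoise θ g i ω) ^ 2))
          = ∏ i, ENNReal.ofReal (Real.exp (c * inner ℝ x (signedNoise θ g i ω) ^ 2)) := fun ω => by
        rw [Finset.mul_sum, Real.exp_sum,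
          ENNReal.ofReal_prod_of_nonneg fun _ _ => (Real.exp_pos _).le]
      simp_rw [hprod]
      have hf : Measurable fun z : EuclideanSpace ℝ (Fin n) =>
        ENNReal.ofReal (Real.exp (c * inner ℝ x z ^ 2)) := by fun_prop
      rw [lintegral_finset_prod_comp_of_iIndepFun _ h.iIndepFun_signedNoise
        h.aemeasurable_signedNoise hf]
      refine (Finset.prod_le_prod' fun i _ =>
        h.lintegral_exp_sq_inner_signedNoise_le hS i x hc0 ?_).trans (by simp)
      have h4 : ‖x‖ ^ 2 ≤ 2 ^ 2 := by gcongr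
      have : 4 * c * (τ * ‖x‖ ^ 2) ≤ 4 * c * (τ * 2 ^ 2) := by gcongr
      refine this.trans (le_of_eq ?_)
      rw [hc]; field_simp; norm_num)
    (ENNReal.ofReal (Real.exp (2 * n + m)))
  rw [ennreal_two_pow_eq, ennreal_two_pow_eq, ← ENNReal.ofReal_mul (Real.exp_pos _).le,
    ← Real.exp_add] at key
  refine (measureReal_mono ?_).trans ((measureReal_le_of_ofReal_exp_mul_le key).trans ?_)
  · rintro ω ⟨v, hv, hω⟩
    refine ⟨v, hv, ENNReal.ofReal_le_ofReal (Real.exp_le_exp.2 ?_)⟩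
    calc (2 * n + m : ℝ) = c * (16 * τ * (2 * n + m)) := by rw [hc]; field_simp
      _ ≤ _ := mul_le_mul_of_nonneg_left hω hc0
  · apply Real.exp_le_exp.2
    have := Real.log_two_lt_d9
    have hn : (0 : ℝ) ≤ n := by positivity
    have hm : (0 : ℝ) ≤ m := by positivity
    nlinarith

omit [NeZero n] in
theorem measureReal_inner_signedNoise_le_le (h : IsGaussianMixtureSample P μ S θ g)
    (hS : ∀ j, (S j).PosDef) (hτ : 0 < noiseLevel S) (i : Fin m) {a : ℝ} (ha : 0 ≤ a) :
    P.real {ω | inner ℝ μ (signedNoise θ g i ω) ≤ -(a * ‖μ‖ ^ 2)}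
      ≤ Real.exp (-(a ^ 2 * signalToNoise μ S / 2)) := by
  set τ := noiseLevel S
  -- The tilt a/τ is the optimal Chernoff parameter along -`μ`.
  have hf : Measurable fun z : EuclideanSpace ℝ (Fin n) =>
    ENNReal.ofReal (Real.exp (inner ℝ (-(a / τ) • μ) z)) := by fun_prop
  have hmarkov := mul_meas_ge_le_lintegral₀
    (hf.comp_aemeasurable (h.aemeasurable_signedNoise i))
    (ENNReal.ofReal (Real.exp (a / τ * (a * ‖μ‖ ^ 2))))
  have key := hmarkov.trans (h.lintegral_exp_inner_signedNoise_le hS i (-(a / τ) • μ))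
  refine (measureReal_mono ?_).trans ((measureReal_le_of_ofReal_exp_mul_le key).trans ?_)
  · intro ω hω
    have hω : inner ℝ μ (signedNoise θ g i ω) ≤ -(a * ‖μ‖ ^ 2) := hω
    refine ENNReal.ofReal_le_ofReal (Real.exp_le_exp.2 ?_)
    rw [real_inner_smul_left, neg_mul, ← mul_neg]
    exact mul_le_mul_of_nonneg_left (by linarith) (by positivity)
  · apply Real.exp_le_exp.2
    rw [norm_smul, mul_pow, norm_neg, Real.norm_of_nonneg (by positivity)]
    apply le_of_eq
    change _ = -(a ^ 2 * (‖μ‖ ^ 2 / τ) / 2)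
    field_simp
    ring

end IsGaussianMixtureSample

/-! ### Deterministic perturbation of the leading eigenvector -/

theorem isHermitian_secondMomentMatrix {n m : ℕ} (x : Fin m → EuclideanSpace ℝ (Fin n)) :
    (secondMomentMatrix x).IsHermitian := by
  ext i j
  simp only [secondMomentMatrix, Matrix.conjTranspose_apply, Matrix.smul_apply, Matrix.sum_apply,
    Matrix.vecMulVec_apply, star_trivial]
  simp_rw [mul_comm]

theorem inner_secondMomentMatrix {n m : ℕ} (x : Fin m → EuclideanSpace ℝ (Fin n))
    (v u : EuclideanSpace ℝ (Fin n)) :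
    inner ℝ v ((secondMomentMatrix x).toEuclideanLin u)
      = (m : ℝ)⁻¹ * ∑ i, inner ℝ v (x i) * inner ℝ u (x i) := by
  have h : (secondMomentMatrix x).toEuclideanLin u
      = (m : ℝ)⁻¹ • ∑ i, inner ℝ u (x i) • x i := by
    apply WithLp.ofLp_injective 2
    simp only [secondMomentMatrix, Matrix.toEuclideanLin, Matrix.toLpLin_apply, Matrix.smul_mulVec,
      Matrix.sum_mulVec, Matrix.vecMulVec_mulVec, WithLp.ofLp_smul, WithLp.ofLp_sum]
    simp [EuclideanSpace.inner_eq_star_dotProduct]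
  rw [h, real_inner_smul_right, inner_sum]
  congr 1
  refine Finset.sum_congr rfl fun i _ => ?_
  rw [real_inner_smul_right, mul_comm]

section Perturbation

variable {n m : ℕ} {μ γ : EuclideanSpace ℝ (Fin n)} {x z : Fin m → EuclideanSpace ℝ (Fin n)}
  {l : Fin m → ℝ} {ρ κ : ℝ}

theorem inner_secondMomentMatrix_signed (hl : ∀ i, l i * l i = 1)
    (hx : ∀ i, x i = l i • (μ + z i)) (v u : EuclideanSpace ℝ (Fin n)) :
    inner ℝ v ((secondMomentMatrix x).toEuclideanLin u)
      = (m : ℝ)⁻¹ * ∑ i, inner ℝ v (μ + z i) * inner ℝ u (μ + z i) := by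
  rw [inner_secondMomentMatrix]
  congr 1
  refine Finset.sum_congr rfl fun i _ => ?_
  rw [hx, real_inner_smul_right, real_inner_smul_right, mul_mul_mul_comm, hl, one_mul]

/-- The component of the leading eigenvector orthogonal to the mean direction is small. -/
theorem IsLeadingEigenvector.norm_orthogonal_le (hm : 1 ≤ m) (hμ : μ ≠ 0)
    (hl : ∀ i, l i * l i = 1) (hx : ∀ i, x i = l i • (μ + z i))
    (hγ : IsLeadingEigenvector (secondMomentMatrix x) γ)
    (hsum : ‖∑ i, z i‖ ≤ m * ρ) (hsq : ∀ v, ‖v‖ ≤ 1 → ∑ i, inner ℝ v (z i) ^ 2 ≤ m * κ)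
    (hρ : 4 * ρ ≤ ‖μ‖) :
    ‖γ - (inner ℝ γ μ / ‖μ‖ ^ 2) • μ‖ * ‖μ‖ ^ 2 ≤ 2 * (ρ * ‖μ‖ + κ) := by
  set M := ‖μ‖ with hM
  have hM0 : 0 < M := norm_pos_iff.2 hμ
  have hm0 : (0 : ℝ) < m := by exact_mod_cast hm
  set L := largestEigenvalue (secondMomentMatrix x)
  set w := γ - (inner ℝ γ μ / M ^ 2) • μ with hw
  have hwμ : inner ℝ w μ = 0 := by
    rw [hw, inner_sub_left, real_inner_smul_left, real_inner_self_eq_norm_sq, ← hM]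
    field_simp; ring
  have hwγ : inner ℝ w γ = ‖w‖ ^ 2 := by
    have : γ = w + (inner ℝ γ μ / M ^ 2) • μ := by rw [hw]; abel
    conv_lhs => rw [this]
    rw [inner_add_right, real_inner_smul_right, hwμ, mul_zero, add_zero, real_inner_self_eq_norm_sq]
  have hsum' : ∀ v : EuclideanSpace ℝ (Fin n), |∑ i, inner ℝ v (z i)| ≤ ‖v‖ * (m * ρ) := fun v => by
    rw [← inner_sum]
    exact (abs_real_inner_le_norm _ _).trans (by gcongr)
  -- Rayleigh quotient at `μ`: the squares ⟨μ, z i⟩² are dropped, and 4ρ ≤ M absorbs the linear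
  -- term.
  have hL : M ^ 2 / 2 ≤ L := by
    have h1 := inner_toEuclideanLin_le_largestEigenvalue (isHermitian_secondMomentMatrix x) μ
    rw [inner_secondMomentMatrix_signed hl hx, inv_mul_le_iff₀ hm0] at h1
    have h2 : ∑ i : Fin m, (M ^ 4 + 2 * M ^ 2 * inner ℝ μ (z i))
        ≤ ∑ i, inner ℝ μ (μ + z i) * inner ℝ μ (μ + z i) := by
      refine Finset.sum_le_sum fun i _ => ?_
      rw [inner_add_right, real_inner_self_eq_norm_sq, ← hM]
      nlinarith [sq_nonneg (inner ℝ μ (z i))]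
    rw [Finset.sum_add_distrib, ← Finset.mul_sum] at h2
    simp only [Finset.sum_const, Finset.card_univ, Fintype.card_fin, nsmul_eq_mul] at h2
    have h3 := (abs_le.1 (hsum' μ)).1
    rw [← hM] at h3 h1
    have h4 : 2 * M ^ 2 * -(M * (m * ρ)) ≤ 2 * M ^ 2 * ∑ i, inner ℝ μ (z i) := by gcongr
    have h5 : 0 ≤ m * M ^ 3 * (M - 4 * ρ) :=
      mul_nonneg (by positivity) (by linarith)
    have h6 : m * M ^ 2 * (M ^ 2 / 2) ≤ m * M ^ 2 * L := by
      change _ ≤ m * (L * M ^ 2) at h1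
      nlinarith
    exact le_of_mul_le_mul_left h6 (by positivity)
  -- After normalizing w, 2ab ≤ a² + b² reduces this to the second-moment bound in the two
  -- directions w and γ.
  have hcross : ∑ i, inner ℝ w (z i) * inner ℝ γ (z i) ≤ m * κ * ‖w‖ := by
    rcases eq_or_ne w 0 with h0 | h0
    · simp [h0]
    have hw0 : 0 < ‖w‖ := norm_pos_iff.2 h0
    have h1 := hsq (‖w‖⁻¹ • w) (by rw [norm_smul, norm_inv, norm_norm]; exact inv_mul_le_one)
    have h2 := hsq γ hγ.norm_eq_one.le
    have h3 : ∑ i, 2 * (inner ℝ (‖w‖⁻¹ • w) (z i) * inner ℝ γ (z i))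
        ≤ ∑ i, (inner ℝ (‖w‖⁻¹ • w) (z i) ^ 2 + inner ℝ γ (z i) ^ 2) :=
      Finset.sum_le_sum fun i _ => by
        nlinarith [sq_nonneg (inner ℝ (‖w‖⁻¹ • w) (z i) - inner ℝ γ (z i))]
    rw [← Finset.mul_sum, Finset.sum_add_distrib] at h3
    have h4 : ∑ i, inner ℝ (‖w‖⁻¹ • w) (z i) * inner ℝ γ (z i)
        = ‖w‖⁻¹ * ∑ i, inner ℝ w (z i) * inner ℝ γ (z i) := by
      rw [Finset.mul_sum]
      exact Finset.sum_congr rfl fun i _ => by rw [real_inner_smul_left, mul_assoc]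
    have h5 : ‖w‖⁻¹ * ∑ i, inner ℝ w (z i) * inner ℝ γ (z i) ≤ m * κ := by
      rw [← h4]; linarith
    rwa [inv_mul_le_iff₀ hw0, mul_comm] at h5
  -- The eigenvalue equation paired with w. As w is orthogonal to `μ`, every surviving term contains
  -- ⟨w, z i⟩.
  have hmain : L * ‖w‖ ^ 2 ≤ (ρ * M + κ) * ‖w‖ := by
    have h1 : inner ℝ w ((secondMomentMatrix x).toEuclideanLin γ) = L * ‖w‖ ^ 2 := by
      rw [hγ.eigen, real_inner_smul_right, hwγ]
    rw [← h1, inner_secondMomentMatrix_signed hl hx, inv_mul_le_iff₀ hm0]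
    have h2 : ∑ i, inner ℝ w (μ + z i) * inner ℝ γ (μ + z i)
        = inner ℝ γ μ * ∑ i, inner ℝ w (z i) + ∑ i, inner ℝ w (z i) * inner ℝ γ (z i) := by
      rw [Finset.mul_sum, ← Finset.sum_add_distrib]
      refine Finset.sum_congr rfl fun i _ => ?_
      rw [inner_add_right, inner_add_right, hwμ]; ring
    rw [h2]
    have h3 : inner ℝ γ μ * ∑ i, inner ℝ w (z i) ≤ M * (‖w‖ * (m * ρ)) := by
      refine (le_abs_self _).trans ?_
      rw [abs_mul]
      have := abs_real_inner_le_norm γ μ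
      rw [hγ.norm_eq_one, one_mul] at this
      exact mul_le_mul this (hsum' w) (abs_nonneg _) hM0.le
    nlinarith
  have hκ : 0 ≤ m * κ := (Finset.sum_nonneg fun i _ => sq_nonneg _).trans (hsq 0 (by simp))
  have hκ0 : 0 ≤ κ := nonneg_of_mul_nonneg_right hκ hm0
  have hρ0 : 0 ≤ ρ := nonneg_of_mul_nonneg_right ((norm_nonneg _).trans hsum) hm0
  rcases (norm_nonneg w).eq_or_lt with h0 | h0
  · rw [← h0, zero_mul]; positivity
  · have h1 : L * ‖w‖ ≤ ρ * M + κ := by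
      refine le_of_mul_le_mul_right ?_ h0
      nlinarith
    have h2 : M ^ 2 / 2 * ‖w‖ ≤ L * ‖w‖ := by gcongr
    linarith

/-- With p = ⟨γ, μ⟩ the quantity equals |p|(1 + ⟨μ, z⟩/‖μ‖²) + s⟨w, z⟩. Here |p| ≥ (1 - e)‖μ‖, the
bracket exceeds 2e, and the last term is at least -e‖μ‖; since 2e ≤ 1, the first term wins. -/
theorem mul_inner_pos_of_norm_orthogonal_le {z : EuclideanSpace ℝ (Fin n)} {s e R : ℝ} (hμ : μ ≠ 0)
    (hγ : ‖γ‖ = 1) (he0 : 0 ≤ e) (he : 2 * e ≤ 1)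
    (hs : s * inner ℝ γ μ = |inner ℝ γ μ|) (hs1 : |s| ≤ 1)
    (hw : ‖γ - (inner ℝ γ μ / ‖μ‖ ^ 2) • μ‖ ≤ e)
    (hwR : ‖γ - (inner ℝ γ μ / ‖μ‖ ^ 2) • μ‖ * R ≤ e * ‖μ‖)
    (hz : ‖z‖ ≤ R) (hμz : -((1 - 2 * e) * ‖μ‖ ^ 2) < inner ℝ μ z) :
    0 < s * inner ℝ γ (μ + z) := by
  set M := ‖μ‖ with hM
  have hM0 : 0 < M := norm_pos_iff.2 hμ
  set p := inner ℝ γ μ with hp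
  set w := γ - (p / M ^ 2) • μ with hw'
  have hdec : γ = w + (p / M ^ 2) • μ := by rw [hw']; abel
  have hpabs : (1 - e) * M ≤ |p| := by
    have h1 : ‖γ‖ ≤ ‖w‖ + ‖(p / M ^ 2) • μ‖ := by
      conv_lhs => rw [hdec]
      exact norm_add_le _ _
    rw [hγ, norm_smul, Real.norm_eq_abs, abs_div, abs_of_pos (by positivity : 0 < M ^ 2), ← hM] at h1
    have h2 : |p| / M ^ 2 * M = |p| / M := by field_simp
    rw [h2] at h1
    have h3 : 1 - e ≤ |p| / M := by linarith
    rwa [le_div_iff₀ hM0] at h3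
  have hpp : 0 < |p| := lt_of_lt_of_le (mul_pos (by linarith) hM0) hpabs
  have hexp : s * inner ℝ γ (μ + z) = |p| * (1 + inner ℝ μ z / M ^ 2) + s * inner ℝ w z := by
    have h1 : inner ℝ γ z = inner ℝ w z + p / M ^ 2 * inner ℝ μ z := by
      conv_lhs => rw [hdec]
      rw [inner_add_left, real_inner_smul_left]
    rw [inner_add_right, ← hp, h1, ← hs]
    field_simp
    ring
  have hwz : -(e * M) ≤ s * inner ℝ w z := by
    have h1 : |s * inner ℝ w z| ≤ e * M := by
      rw [abs_mul]
      calc |s| * |inner ℝ w z| ≤ 1 * (‖w‖ * ‖z‖) :=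
            mul_le_mul hs1 (abs_real_inner_le_norm _ _) (abs_nonneg _) zero_le_one
        _ ≤ ‖w‖ * R := by rw [one_mul]; gcongr
        _ ≤ e * M := hwR
    exact (abs_le.1 h1).1
  have h2 : 2 * e < 1 + inner ℝ μ z / M ^ 2 := by
    have : -(1 - 2 * e) < inner ℝ μ z / M ^ 2 := by
      rw [lt_div_iff₀ (by positivity)]; linarith
    linarith
  have h3 : |p| * (2 * e) < |p| * (1 + inner ℝ μ z / M ^ 2) := by gcongr
  have h4 : (1 - e) * M * (2 * e) ≤ |p| * (2 * e) := by gcongr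
  have h5 : 0 ≤ e * M * (1 - 2 * e) := mul_nonneg (by positivity) (by linarith)
  rw [hexp]
  nlinarith

end Perturbation

/-! ### Orders of magnitude -/

/-- The orders of magnitude of the error terms when `n / √m` and `n ^ (1/3)` are small compared to
the signal-to-noise ratio `M² / τ`. -/
theorem noise_bounds {n m M τ η b : ℝ} (hn : 1 ≤ n) (hm : 1 ≤ m) (hM : 0 < M) (hτ : 0 < τ)
    (hη : η = M ^ 2 / τ) (hb0 : 0 ≤ b) (hb : b ≤ 1) (h1 : n / √m ≤ b ^ 2 * η)
    (h2 : n ^ (1 / 3 : ℝ) ≤ b ^ 2 * η) :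
    ∃ ρ κ, 4 * √(m * τ * n) = m * ρ ∧ 16 * τ * (2 * n + m) = m * κ ∧ ρ ≤ 4 * b * M ∧
      2 * (ρ * M + κ) ≤ 104 * b * M ^ 2 ∧
      2 * (ρ * M + κ) * (4 * √(τ * n)) ≤ 416 * b * M ^ 3 := by
  have hη0 : 0 < η := by rw [hη]; positivity
  obtain ⟨r, hr, rfl⟩ : ∃ r, 1 ≤ r ∧ n = r ^ 2 :=
    ⟨√n, Real.one_le_sqrt.2 hn, (Real.sq_sqrt (by linarith)).symm⟩
  obtain ⟨q, hq, rfl⟩ : ∃ q, 1 ≤ q ∧ m = q ^ 2 :=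
    ⟨√m, Real.one_le_sqrt.2 hm, (Real.sq_sqrt (by linarith)).symm⟩
  obtain ⟨h, hh, rfl⟩ : ∃ h, 0 < h ∧ η = h ^ 2 :=
    ⟨√η, Real.sqrt_pos.2 hη0, (Real.sq_sqrt hη0.le).symm⟩
  have hτ' : τ = (M / h) ^ 2 := by
    rw [div_pow, hη]; field_simp
  have hr0 : 0 < r := by linarith
  have hq0 : 0 < q := by linarith
  rw [Real.sqrt_sq hq0.le] at h1
  have h3 : r ≤ b ^ 3 * h ^ 3 := by
    have : (r ^ 2 : ℝ) ≤ (b ^ 3 * h ^ 3) ^ 2 := by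
      calc r ^ 2 = ((r ^ 2) ^ (1 / 3 : ℝ)) ^ 3 := by
            rw [← Real.rpow_natCast ((r ^ 2) ^ (1 / 3 : ℝ)), ← Real.rpow_mul (by positivity)]
            norm_num
        _ ≤ (b ^ 2 * h ^ 2) ^ 3 := by gcongr
        _ = _ := by ring
    exact (pow_le_pow_iff_left₀ hr0.le (by positivity) two_ne_zero).1 this
  have hbh : 1 ≤ b * h := by
    have : 1 ≤ (b * h) ^ 3 := by rw [mul_pow]; linarith
    by_contra hlt
    exact absurd this (not_le.2 (pow_lt_one₀ (by positivity) (not_le.1 hlt) three_ne_zero))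
  -- In units of M, u = √(τn/m)/M is the size of the mean noise and k = √τ/M that of one noise
  -- coordinate; rk = √(τn)/M is the order of a full noise vector. The hypotheses read u·rk ≤ b² and
  -- k²·rk ≤ b³.
  set u := r / (h * q) with hu
  set k := 1 / h with hk
  have hu0 : 0 < u := by positivity
  have hk0 : 0 < k := by positivity
  have hkb : k ≤ b := by rw [hk, div_le_iff₀ hh]; exact hbh
  have hurk : u * (r * k) ≤ b ^ 2 := by
    have : u * (r * k) = r ^ 2 / q / h ^ 2 := by rw [hu, hk]; field_simp
    rw [this, div_le_iff₀ (by positivity)]; exact h1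
  -- Since q ≥ 1, u ≤ rk, whence u² ≤ u·rk ≤ b².
  have hub : u ≤ b := by
    have e1 : u ≤ r * k := by
      rw [hu, hk, mul_one_div]
      gcongr
      nlinarith
    have : u ^ 2 ≤ b ^ 2 := by nlinarith
    exact (pow_le_pow_iff_left₀ hu0.le hb0 two_ne_zero).1 this
  have hrk3 : k ^ 2 * (r * k) ≤ b ^ 3 := by
    have : k ^ 2 * (r * k) = r / h ^ 3 := by rw [hk]; field_simp
    rw [this, div_le_iff₀ (by positivity)]; exact h3
  have hb2 : b ^ 2 ≤ b := by nlinarith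
  have hb3 : b ^ 3 ≤ b := by nlinarith
  refine ⟨4 * u * M, 16 * M ^ 2 * (2 * u ^ 2 + k ^ 2), ?_, ?_, ?_, ?_, ?_⟩
  · rw [hτ', show q ^ 2 * (M / h) ^ 2 * r ^ 2 = (q * (M / h) * r) ^ 2 by ring,
      Real.sqrt_sq (by positivity), hu]
    field_simp
  · rw [hτ', hu, hk]; field_simp
  · gcongr
  · have : u ^ 2 ≤ b := by nlinarith
    have : k ^ 2 ≤ b := by nlinarith
    have : 4 * u + 16 * (2 * u ^ 2 + k ^ 2) ≤ 52 * b := by linarith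
    nlinarith [mul_le_mul_of_nonneg_right this (sq_nonneg M)]
  · rw [hτ', show (M / h) ^ 2 * r ^ 2 = (M * (r * k)) ^ 2 by rw [hk]; ring,
      Real.sqrt_sq (by positivity)]
    have e1 : u ^ 2 * (r * k) ≤ b ^ 3 := by
      calc u ^ 2 * (r * k) = u * (u * (r * k)) := by ring
        _ ≤ b * b ^ 2 := by gcongr
        _ = b ^ 3 := by ring
    have e2 : 32 * (u * (r * k)) + 256 * (u ^ 2 * (r * k)) + 128 * (k ^ 2 * (r * k)) ≤ 416 * b := by
      linarith
    nlinarith [mul_le_mul_of_nonneg_right e2 (pow_pos hM 3).le]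

/-! ### Bad events and their probabilities -/

namespace IsGaussianMixtureSample

variable {n m : ℕ} {Ω : Type*} [MeasurableSpace Ω] {P : Measure Ω}
  {μ : EuclideanSpace ℝ (Fin n)} {S : ℤˣ → Matrix (Fin n) (Fin n) ℝ}
  {θ : Fin m → Ω → ℤˣ} {g : Fin m → ℤˣ → Ω → EuclideanSpace ℝ (Fin n)}

/-- The event that the empirical mean or the empirical second moment of the noise is large. -/
def globalBad (S : ℤˣ → Matrix (Fin n) (Fin n) ℝ) (θ : Fin m → Ω → ℤˣ)
    (g : Fin m → ℤˣ → Ω → EuclideanSpace ℝ (Fin n)) : Set Ω :=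
  {ω | 4 * √(m * noiseLevel S * n) ≤ ‖∑ i, signedNoise θ g i ω‖} ∪
  {ω | ∃ v : EuclideanSpace ℝ (Fin n), ‖v‖ ≤ 1 ∧
      16 * noiseLevel S * (2 * n + m) ≤ ∑ i, inner ℝ v (signedNoise θ g i ω) ^ 2}

/-- The event that the noise of observation `i` is large. -/
def localBad (μ : EuclideanSpace ℝ (Fin n)) (S : ℤˣ → Matrix (Fin n) (Fin n) ℝ)
    (θ : Fin m → Ω → ℤˣ) (g : Fin m → ℤˣ → Ω → EuclideanSpace ℝ (Fin n)) (e : ℝ) (i : Fin m) :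
    Set Ω :=
  {ω | 4 * √(noiseLevel S * n) ≤ ‖signedNoise θ g i ω‖} ∪
  {ω | inner ℝ μ (signedNoise θ g i ω) ≤ -((1 - 2 * e) * ‖μ‖ ^ 2)}

theorem noiseLevel_pos (hS : ∀ j, (S j).PosDef) (hμ : μ ≠ 0) : 0 < noiseLevel S :=
  lt_of_lt_of_le (largestEigenvalue_pos (hS 1) hμ) (le_max_right _ _)

theorem one_le_dim (hμ : μ ≠ 0) : 1 ≤ n := by
  rcases Nat.eq_zero_or_pos n with rfl | h
  · exact absurd (Subsingleton.elim μ 0) hμ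
  · exact h

theorem measureReal_globalBad_le [IsProbabilityMeasure P] (h : IsGaussianMixtureSample P μ S θ g)
    (hS : ∀ j, (S j).PosDef) (hμ : μ ≠ 0) (hm : 1 ≤ m) :
    P.real (globalBad S θ g) ≤ 2 * Real.exp (-n) := by
  have : NeZero n := ⟨Nat.one_le_iff_ne_zero.1 (one_le_dim hμ)⟩
  have hτ := noiseLevel_pos hS hμ
  have h1 := h.measureReal_norm_sum_signedNoise_ge_le hS hτ hm
  have h2 := h.measureReal_exists_sum_sq_inner_ge_le hS hτ
  have h3 : Real.exp (-(5 / 4 * n)) ≤ Real.exp (-n) :=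
    Real.exp_le_exp.2 (by have : (0 : ℝ) ≤ n := by positivity
                          linarith)
  refine (measureReal_union_le _ _).trans ?_
  linarith

theorem measureReal_localBad_le [IsProbabilityMeasure P] (h : IsGaussianMixtureSample P μ S θ g)
    (hS : ∀ j, (S j).PosDef) (hμ : μ ≠ 0) {e : ℝ} (he : 2 * e ≤ 1) (i : Fin m) :
    P.real (localBad μ S θ g e i)
      ≤ Real.exp (-(5 / 4 * n)) + Real.exp (-((1 - 2 * e) ^ 2 * signalToNoise μ S / 2)) := by
  have : NeZero n := ⟨Nat.one_le_iff_ne_zero.1 (one_le_dim hμ)⟩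
  have hτ := noiseLevel_pos hS hμ
  exact (measureReal_union_le _ _).trans (add_le_add
    (h.measureReal_norm_signedNoise_ge_le hS hτ i)
    (h.measureReal_inner_signedNoise_le_le hS hτ i (by linarith)))

omit [MeasurableSpace Ω] in
theorem labelReal_mul_inner_pos {γ : EuclideanSpace ℝ (Fin n)} (hm : 1 ≤ m) (hμ : μ ≠ 0)
    (hS : ∀ j, (S j).PosDef) {ω : Ω}
    (hγ : IsLeadingEigenvector (secondMomentMatrix fun i => mixtureVector μ (θ i) (g i) ω) γ)
    {e b : ℝ} (hb0 : 0 ≤ b) (hb : 416 * b ≤ e) (he : 2 * e ≤ 1)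
    (h1 : (n : ℝ) / √m ≤ b ^ 2 * signalToNoise μ S)
    (h2 : (n : ℝ) ^ (1 / 3 : ℝ) ≤ b ^ 2 * signalToNoise μ S)
    (hω : ω ∉ globalBad S θ g) {s : ℤˣ} (hs : labelReal s * inner ℝ γ μ = |inner ℝ γ μ|)
    {i : Fin m} (hi : ω ∉ localBad μ S θ g e i) :
    0 < labelReal (s * θ i ω) * inner ℝ γ (mixtureVector μ (θ i) (g i) ω) := by
  have hM : 0 < ‖μ‖ := norm_pos_iff.2 hμ
  obtain ⟨ρ, κ, hρ, hκ, hρM, hd, hdR⟩ := noise_bounds (n := n) (m := m)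
    (by exact_mod_cast one_le_dim hμ) (by exact_mod_cast hm) hM (noiseLevel_pos hS hμ)
    (rfl : signalToNoise μ S = _) hb0 (by linarith) h1 h2
  simp only [globalBad, Set.mem_union, Set.mem_ofPred_eq, not_or, not_exists, not_and, not_le] at hω
  simp only [localBad, Set.mem_union, Set.mem_ofPred_eq, not_or, not_le] at hi
  rw [hρ, hκ] at hω
  have hw := hγ.norm_orthogonal_le hm hμ (fun i => labelReal_mul_self (θ i ω))
    (fun i => mixtureVector_eq μ θ g i ω) hω.1.le (fun v hv => (hω.2 v hv).le)
    (by nlinarith)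
  have key := mul_inner_pos_of_norm_orthogonal_le (e := e) (R := 4 * √(noiseLevel S * n)) hμ
    hγ.norm_eq_one (by linarith) he hs
    (by rcases Int.units_eq_one_or s with rfl | rfl <;> simp [labelReal])
    (le_of_mul_le_mul_right (hw.trans (hd.trans (mul_le_mul_of_nonneg_right (by linarith)
      (by positivity)))) (by positivity : 0 < ‖μ‖ ^ 2))
    (le_of_mul_le_mul_right (by
      calc _ = (‖γ - (inner ℝ γ μ / ‖μ‖ ^ 2) • μ‖ * ‖μ‖ ^ 2) * (4 * √(noiseLevel S * n)) := by ring
        _ ≤ 2 * (ρ * ‖μ‖ + κ) * (4 * √(noiseLevel S * n)) := by gcongr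
        _ ≤ 416 * b * ‖μ‖ ^ 3 := hdR
        _ ≤ e * ‖μ‖ ^ 3 := by gcongr
        _ = e * ‖μ‖ * ‖μ‖ ^ 2 := by ring) (by positivity : 0 < ‖μ‖ ^ 2))
    hi.1.le hi.2
  rw [mixtureVector_eq, real_inner_smul_right, labelReal_mul, mul_assoc, ← mul_assoc (labelReal (θ i ω)),
    labelReal_mul_self, one_mul]
  exact key

theorem one_sub_measureReal_le [IsProbabilityMeasure P] (h : IsGaussianMixtureSample P μ S θ g)
    (hS : ∀ j, (S j).PosDef) (hμ : μ ≠ 0) (hm : 1 ≤ m) {e : ℝ} (he : 2 * e ≤ 1) {T : Set Ω}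
    (hT : ∀ᵐ ω ∂P, ω ∉ globalBad S θ g → (∀ i, ω ∉ localBad μ S θ g e i) → ω ∈ T) :
    1 - P.real T ≤ 2 * Real.exp (-n) + m * (Real.exp (-(5 / 4 * n))
      + Real.exp (-((1 - 2 * e) ^ 2 * signalToNoise μ S / 2))) := by
  -- Covering the whole space and using subadditivity avoids complements, so `T` need not be
  -- measurable.
  have h1 : P.real Set.univ ≤ P.real (T ∪ (globalBad S θ g ∪ ⋃ i, localBad μ S θ g e i)) := by
    refine ENNReal.toReal_mono (measure_ne_top _ _) (measure_mono_ae ?_)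
    filter_upwards [hT] with ω hω _
    by_contra hcon
    have hcon' : ω ∉ T ∪ (globalBad S θ g ∪ ⋃ i, localBad μ S θ g e i) := hcon
    simp only [Set.mem_union, Set.mem_iUnion, not_or, not_exists] at hcon'
    exact hcon'.1 (hω hcon'.2.1 hcon'.2.2)
  have h2 := measureReal_union_le (μ := P) T (globalBad S θ g ∪ ⋃ i, localBad μ S θ g e i)
  have h3 := measureReal_union_le (μ := P) (globalBad S θ g) (⋃ i, localBad μ S θ g e i)
  have h4 := h.measureReal_globalBad_le hS hμ hm
  have h5 : P.real (⋃ i, localBad μ S θ g e i) ≤ m * (Real.exp (-(5 / 4 * n))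
      + Real.exp (-((1 - 2 * e) ^ 2 * signalToNoise μ S / 2))) := by
    refine (measureReal_iUnion_fintype_le _).trans ((Finset.sum_le_sum fun i _ =>
      h.measureReal_localBad_le hS hμ he i).trans ?_)
    simp [mul_add]
  rw [probReal_univ] at h1
  linarith

/-- For a single observation only its own local event matters, so no factor m appears. The 3 counts
two global failures and one large norm. -/
theorem measureReal_le_of_ae [IsProbabilityMeasure P] (h : IsGaussianMixtureSample P μ S θ g)
    (hS : ∀ j, (S j).PosDef) (hμ : μ ≠ 0) (hm : 1 ≤ m) {e : ℝ} (he : 2 * e ≤ 1) (i : Fin m)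
    {T : Set Ω}
    (hT : ∀ᵐ ω ∂P, ω ∈ T → ω ∈ globalBad S θ g ∨ ω ∈ localBad μ S θ g e i) :
    P.real T ≤ Real.exp (-((1 - 2 * e) ^ 2 * signalToNoise μ S / 2)) + 3 * Real.exp (-n) := by
  have h1 : P.real T ≤ P.real (globalBad S θ g ∪ localBad μ S θ g e i) :=
    ENNReal.toReal_mono (measure_ne_top _ _) (measure_mono_ae hT)
  have h2 := measureReal_union_le (μ := P) (globalBad S θ g) (localBad μ S θ g e i)
  have h3 := h.measureReal_globalBad_le hS hμ hm
  have h4 := h.measureReal_localBad_le hS hμ he i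
  have h5 : Real.exp (-(5 / 4 * n)) ≤ Real.exp (-n) :=
    Real.exp_le_exp.2 (by have : (0 : ℝ) ≤ n := by positivity
                          linarith)
  linarith

end IsGaussianMixtureSample

/-! ### The asymptotic statement -/

theorem exists_labelReal_mul_eq_abs (p : ℝ) : ∃ s : ℤˣ, labelReal s * p = |p| := by
  rcases le_total 0 p with h | h
  · exact ⟨1, by simp [labelReal, abs_of_nonneg h]⟩
  · exact ⟨-1, by simp [labelReal, abs_of_nonpos h]⟩

open IsGaussianMixtureSample

theorem corollary1
    (n m : ℕ → ℕ)
    (μ : ∀ k, EuclideanSpace ℝ (Fin (n k)))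
    (S : ∀ k, ℤˣ → Matrix (Fin (n k)) (Fin (n k)) ℝ)
    {Ω : ℕ → Type*} [∀ k, MeasurableSpace (Ω k)]
    (P : ∀ k, Measure (Ω k)) [∀ k, IsProbabilityMeasure (P k)]
    (θ : ∀ k, Fin (m k) → Ω k → ℤˣ)
    (g : ∀ k, Fin (m k) → ℤˣ → Ω k → EuclideanSpace ℝ (Fin (n k)))
    (X : ∀ k, Fin (m k) → Ω k → EuclideanSpace ℝ (Fin (n k)))
    (γ : ∀ k, Ω k → EuclideanSpace ℝ (Fin (n k)))
    (hm : ∀ k, 1 ≤ m k)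
    (hμ : ∀ k, μ k ≠ 0)
    (hS : ∀ k j, (S k j).PosDef)
    (hsample : ∀ k, IsGaussianMixtureSample (P k) (μ k) (S k) (θ k) (g k))
    (hX : ∀ k i ω, X k i ω = mixtureVector (μ k) (θ k i) (g k i) ω)
    -- `γ k` is the leading eigenvector of the sample matrix, of either sign
    (hγ_meas : ∀ k, AEMeasurable (γ k) (P k))
    (hγ : ∀ k, ∀ᵐ ω ∂(P k),
      IsLeadingEigenvector (secondMomentMatrix fun i => X k i ω) (γ k ω))
    (hn : Tendsto n atTop atTop)
    (hmn : Tendsto (fun k => Real.log (m k) / (n k : ℝ)) atTop (𝓝 0))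
    (hη : Tendsto (fun k => (signalToNoise (μ k) (S k))⁻¹ *
        max ((n k : ℝ) / √(m k : ℝ)) (max ((n k : ℝ) ^ (1 / 3 : ℝ)) (Real.log (m k))))
      atTop (𝓝 0)) :
    -- whatever the sign of the eigenvector, the two clusters are recovered
    Tendsto (fun k => (P k).real {ω | ∃ s : ℤˣ, ∀ i : Fin (m k),
        0 < labelReal (s * θ k i ω) * inner ℝ (γ k ω) (X k i ω)}) atTop (𝓝 1) ∧
    -- if the sign is fixed by the mean direction, so are the labels
    ((∀ k, ∀ᵐ ω ∂(P k), 0 ≤ inner ℝ (γ k ω) (μ k)) →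
      Tendsto (fun k => (P k).real {ω | ∀ i : Fin (m k),
        0 < labelReal (θ k i ω) * inner ℝ (γ k ω) (X k i ω)}) atTop (𝓝 1) ∧
      ∀ ε : ℝ, 0 < ε → ε < 1 → ∀ᶠ k in atTop, ∀ i : Fin (m k),
        (P k).real {ω | labelReal (θ k i ω) * inner ℝ (γ k ω) (X k i ω) < 0} ≤
          Real.exp (-((1 - ε) * signalToNoise (μ k) (S k) / 2)) + 10 * Real.exp (-(n k : ℝ))) := by
  simp_rw [hX] at hγ ⊢
  set η : ℕ → ℝ := fun k => signalToNoise (μ k) (S k) with hηdef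
  have hη0 : ∀ k, 0 < η k := fun k => by
    have h1 := norm_pos_iff.2 (hμ k)
    have h2 := noiseLevel_pos (hS k) (hμ k)
    exact div_pos (by positivity) h2
  have hn1 : ∀ k, (1 : ℝ) ≤ n k := fun k => by exact_mod_cast one_le_dim (hμ k)
  have hsmall : ∀ c : ℝ, 0 < c → ∀ᶠ k in atTop, (n k : ℝ) / √(m k : ℝ) ≤ c * η k ∧
      (n k : ℝ) ^ (1 / 3 : ℝ) ≤ c * η k ∧ Real.log (m k) ≤ c * η k := by
    intro c hc
    filter_upwards [hη.eventually_le_const hc] with k hk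
    rw [inv_mul_le_iff₀ (hη0 k), max_le_iff, max_le_iff, mul_comm] at hk
    exact hk
  -- Already n^(1/3) ≥ 1 is negligible against η.
  have hηinf : Tendsto η atTop atTop := by
    rw [tendsto_atTop]
    intro A
    filter_upwards [hsmall (|A| + 1)⁻¹ (by positivity)] with k hk
    have h1 : (1 : ℝ) ≤ (n k : ℝ) ^ (1 / 3 : ℝ) := Real.one_le_rpow (hn1 k) (by norm_num)
    have h2 := h1.trans hk.2.1
    rw [inv_mul_eq_div, le_div_iff₀ (by positivity), one_mul] at h2
    linarith [le_abs_self A]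
  have hninf : Tendsto (fun k => (n k : ℝ)) atTop atTop := tendsto_natCast_atTop_atTop.comp hn
  have hlim : Tendsto (fun k => 3 * Real.exp (-(n k : ℝ)) + Real.exp (-(η k / 4))) atTop (𝓝 0) := by
    have h1 := (Real.tendsto_exp_neg_atTop_nhds_zero.comp hninf).const_mul 3
    have h2 := Real.tendsto_exp_neg_atTop_nhds_zero.comp
      (hηinf.atTop_div_const (by norm_num : (0 : ℝ) < 4))
    simpa using h1.add h2
  have hbound : ∀ᶠ k in atTop, 2 * Real.exp (-(n k : ℝ)) + m k * (Real.exp (-(5 / 4 * n k))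
      + Real.exp (-((1 - 2 * (1 / 8)) ^ 2 * η k / 2)))
      ≤ 3 * Real.exp (-(n k : ℝ)) + Real.exp (-(η k / 4)) := by
    -- At e = 1/8 the exponent is 9η/32, so log m ≤ η/32 leaves η/4; likewise log m ≤ n/4 turns 5n/4
    -- into n.
    filter_upwards [hsmall (1 / 32) (by norm_num),
      hmn.eventually_le_const (by norm_num : (0 : ℝ) < 1 / 4)] with k hk1 hk2
    have hmpos : (0 : ℝ) < m k := by exact_mod_cast hm k
    rw [div_le_iff₀ (by linarith [hn1 k])] at hk2
    have e1 : m k * Real.exp (-(5 / 4 * n k)) ≤ Real.exp (-(n k : ℝ)) := by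
      nth_rewrite 1 [← Real.exp_log hmpos]
      rw [← Real.exp_add]
      exact Real.exp_le_exp.2 (by linarith)
    have e2 : m k * Real.exp (-((1 - 2 * (1 / 8)) ^ 2 * η k / 2)) ≤ Real.exp (-(η k / 4)) := by
      nth_rewrite 1 [← Real.exp_log hmpos]
      rw [← Real.exp_add]
      exact Real.exp_le_exp.2 (by linarith [hk1.2.2])
    linarith
  have htendsto : ∀ T : ∀ k, Set (Ω k),
      (∀ᶠ k in atTop, ∀ᵐ ω ∂(P k), ω ∉ globalBad (S k) (θ k) (g k) →
        (∀ i, ω ∉ localBad (μ k) (S k) (θ k) (g k) (1 / 8) i) → ω ∈ T k) →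
      Tendsto (fun k => (P k).real (T k)) atTop (𝓝 1) := by
    intro T hT
    have hlow : Tendsto (fun k => 1 - (3 * Real.exp (-(n k : ℝ)) + Real.exp (-(η k / 4)))) atTop
        (𝓝 1) := by simpa using hlim.const_sub 1
    refine tendsto_of_tendsto_of_tendsto_of_le_of_le' hlow tendsto_const_nhds ?_
      (Eventually.of_forall fun k => measureReal_le_one)
    filter_upwards [hbound, hT] with k hk1 hk2
    have := (hsample k).one_sub_measureReal_le (hS k) (hμ k) (hm k) (by norm_num) hk2
    linarith
  have hcorrect : ∀ e : ℝ, 0 < e → 2 * e ≤ 1 → ∀ᶠ k in atTop, ∀ᵐ ω ∂(P k),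
      ω ∉ globalBad (S k) (θ k) (g k) → ∀ s : ℤˣ,
      labelReal s * inner ℝ (γ k ω) (μ k) = |inner ℝ (γ k ω) (μ k)| →
      ∀ i, ω ∉ localBad (μ k) (S k) (θ k) (g k) e i →
      0 < labelReal (s * θ k i ω)
        * inner ℝ (γ k ω) (mixtureVector (μ k) (θ k i) (g k i) ω) := by
    intro e he0 he
    filter_upwards [hsmall ((e / 416) ^ 2) (by positivity)] with k hk
    filter_upwards [hγ k] with ω hω hglob s hs i hi
    exact labelReal_mul_inner_pos (hm k) (hμ k) (hS k) hω (by positivity : 0 ≤ e / 416)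
      (by linarith) he hk.1 hk.2.1 hglob hs hi
  refine ⟨htendsto _ ?_, fun hsign => ⟨htendsto _ ?_, ?_⟩⟩
  · filter_upwards [hcorrect (1 / 8) (by norm_num) (by norm_num)] with k hk
    filter_upwards [hk] with ω hω hglob hloc
    obtain ⟨s, hs⟩ := exists_labelReal_mul_eq_abs (inner ℝ (γ k ω) (μ k))
    exact ⟨s, fun i => hω hglob s hs i (hloc i)⟩
  · filter_upwards [hcorrect (1 / 8) (by norm_num) (by norm_num)] with k hk
    filter_upwards [hk, hsign k] with ω hω hsgn hglob hloc i
    simpa using hω hglob 1 (by simp [labelReal, abs_of_nonneg hsgn]) i (hloc i)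
  · intro ε hε0 hε1
    -- With e = ε/8 the rate factor (1 - ε/4)² is at least 1 - ε/2, hence at least 1 - ε.
    filter_upwards [hcorrect (ε / 8) (by linarith) (by linarith)] with k hk i
    have h1 := (hsample k).measureReal_le_of_ae (hS k) (hμ k) (hm k) (e := ε / 8) (by linarith) i
      (T := {ω | labelReal (θ k i ω)
        * inner ℝ (γ k ω) (mixtureVector (μ k) (θ k i) (g k i) ω) < 0}) (by
        filter_upwards [hk, hsign k] with ω hω hsgn hneg
        by_contra hcon
        rw [not_or] at hcon
        have := hω hcon.1 1 (by simp [labelReal, abs_of_nonneg hsgn]) i hcon.2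
        rw [one_mul] at this
        exact absurd hneg (not_lt.2 this.le))
    have h2 : Real.exp (-((1 - 2 * (ε / 8)) ^ 2 * η k / 2))
        ≤ Real.exp (-((1 - ε) * η k / 2)) := by
      refine Real.exp_le_exp.2 ?_
      have : 1 - ε ≤ (1 - 2 * (ε / 8)) ^ 2 := by nlinarith
      nlinarith [mul_le_mul_of_nonneg_right this (hη0 k).le]
    have h3 := Real.exp_pos (-(n k : ℝ))
    linarith
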